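/- Let $G=(V,E)$ be a finite simple graph with $n$ vertices and let $a>b>0$ be integers. A path partition of $G$ is a partition of $V$ into vertex-disjoint paths of $G$ (paths of length $0$ allowed). Min-DPC asks for a path partition with the fewest paths. Min-SLDPC asks, for an instance $(G,a,b)$, for a path partition $\mathcal P$ minimizing $$\mathrm{cost}(\mathcal P)=n(a+b)+\sum_{p\in\mathcal P}w(p),$$ where $w(p)=a$ if $p$ has exactly one edge and $w(p)=a+b$ otherwise. A path partition has ratio $r$ if its cost is at most $r$ times the minimum cost. Put $$\rho(a,b)=\min\left\{\frac{a+b}{a},\ \frac{3a+2b}{2a+2b}\right\}.$$ 1. Let $\mathcal P$ be any optimal solution of Min-DPC on $G$, and let $\mathcal Q$ be the path partition formed by the edges of any maximum matching of $G$ and the vertices it leaves uncovered. Then the cheaper of $\mathcal P$ and $\mathcal Q$ is a solution of Min-SLDPC on $(G,a,b)$ of ratio $\rho(a,b)$. 2. Let $\mathcal C$ be any class of finite graphs on which Min-DPC can be solved in polynomial time. Then there is a polynomial-time algorithm for Min-SLDPC restricted to instances $(G,a,b)$ with $G\in\mathcal C$ and integers $a>b>0$ (written in binary) which returns a solution of ratio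 $\rho(a,b)$; in particular there is a polynomial-time $\frac{1+\sqrt3}{2}$-approximation algorithm on these instances. 3. For all real $a>b>0$ we have $\rho(a,b)\le\frac{1+\sqrt3}{2}$, with equality if and only if $a=(1+\sqrt3)\,b$. Here $\frac{1+\sqrt3}{2}\approx1.37$, that is, $\left|\frac{1+\sqrt3}{2}-1.37\right|<0.005$. -/

import Mathlib

open Computability

/-! ### Disjoint path covers -/

/-- A path of `G`, given by its sequence of vertices: at least one vertex, no repetition, and
consecutive vertices are adjacent. -/
def IsPathSeq {V : Type*} (G : SimpleGraph V) (p : List V) : Prop :=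
  p ≠ [] ∧ p.Nodup ∧ p.IsChain G.Adj

/-- The length of a path is its number of edges. -/
def pathLength {V : Type*} (p : List V) : ℕ := p.length - 1

/-- `P` lists the members of a partition of the vertices of `G` into vertex-disjoint paths
(paths of length `0` are allowed). As all members are non-empty and disjoint, nothing is listed
twice, and `P.length` is the number of paths. -/
def IsPathPartition {V : Type*} (G : SimpleGraph V) (P : List (List V)) : Prop :=
  (∀ p ∈ P, IsPathSeq G p) ∧ P.flatten.Nodup ∧ ∀ v : V, v ∈ P.flatten

/-- Optimal solutions of Minimum Disjoint-Path Cover: partitions of `G` into a minimum number of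
vertex-disjoint paths. -/
def IsMinPathPartition {V : Type*} (G : SimpleGraph V) (P : List (List V)) : Prop :=
  IsPathPartition G P ∧ ∀ P', IsPathPartition G P' → P.length ≤ P'.length

/-! ### Minimum Schedule-Linked Disjoint-Path Cover -/

/-- The weight of a path: `a` for a path with exactly one edge, and `a + b` otherwise. -/
def pathWeight {V : Type*} (a b : ℕ) (p : List V) : ℕ :=
  if pathLength p = 1 then a else a + b

/-- The objective function `n (a + b) + ∑ w(p)` of Min-SLDPC. -/
def sldpcCost (V : Type*) [Fintype V] (a b : ℕ) (P : List (List V)) : ℕ :=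
  Fintype.card V * (a + b) + (P.map (pathWeight a b)).sum

/-- `P` is a feasible solution of the Min-SLDPC instance `(G, a, b)` whose cost is at most `r`
times the cost of every feasible solution, that is, at most `r` times the optimum. -/
def IsSLDPCApprox {V : Type*} [Fintype V] (G : SimpleGraph V) (a b : ℕ) (r : ℝ)
    (P : List (List V)) : Prop :=
  IsPathPartition G P ∧
    ∀ P', IsPathPartition G P' → (sldpcCost V a b P : ℝ) ≤ r * (sldpcCost V a b P' : ℝ)

/-! ### The matching strategy -/

/-- `M` is a matching of `G` with the maximum number of edges. -/
def IsMaximumMatching {V : Type*} {G : SimpleGraph V} (M : G.Subgraph) : Prop :=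
  M.IsMatching ∧ ∀ M' : G.Subgraph, M'.IsMatching → M'.edgeSet.ncard ≤ M.edgeSet.ncard

/-- `Q` is the partition of `G` formed by the edges of the matching `M`, as paths of length `1`,
and the vertices that `M` leaves uncovered, as paths of length `0`. -/
def IsMatchingPartition {V : Type*} {G : SimpleGraph V} (M : G.Subgraph)
    (Q : List (List V)) : Prop :=
  IsPathPartition G Q ∧
    ∀ q ∈ Q, (∃ u v, M.Adj u v ∧ q = [u, v]) ∨ (∃ v, v ∉ M.verts ∧ q = [v])

/-- The ratio of the combined strategy. -/
noncomputable def combinedRatio (a b : ℝ) : ℝ :=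
  min ((a + b) / a) ((3 * a + 2 * b) / (2 * a + 2 * b))

/-! ### Polynomial time -/

/-- A search problem with instances `I`, candidate outputs `O` and relation `R` (`R i o`: the
output `o` is a correct answer to `i`) is solvable in polynomial time if a Turing machine computes
a correct answer to every instance in time polynomial in the length of the encoded instance. -/
def SolvableInPolyTime {I O Γ₀ Γ₁ : Type} (encI : I → List Γ₀) (encO : O → List Γ₁)
    (R : I → O → Prop) : Prop :=
  ∃ f : I → O, (∀ i, R i (f i)) ∧ Nonempty (Turing.TM2ComputableInPolyTime encI encO f)

/-- A finite graph, with vertices `0, …, n - 1`. -/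
structure FiniteGraph where
  n : ℕ
  G : SimpleGraph (Fin n)

/-- An instance of Min-SLDPC. -/
structure SLDPCInstance where
  graph : FiniteGraph
  a : ℕ
  b : ℕ
  b_pos : 0 < b
  b_lt_a : b < a

/-- Numbers are written in binary. -/
def encodeNumber (m : ℕ) : List Γ' := (encodeNat m).map Γ'.bit

open Classical in
/-- A graph is written as its number of vertices in unary, a comma, and its adjacency matrix, row
by row. -/
noncomputable def encodeGraph (g : FiniteGraph) : List Γ' :=
  List.replicate g.n (Γ'.bit true) ++ [Γ'.comma] ++
    List.ofFn (fun k : Fin (g.n * g.n) => Γ'.bit (decide (g.G.Adj k.divNat k.modNat)))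

/-- An instance of Min-SLDPC is written as `a` and `b`, in binary, followed by the graph. -/
noncomputable def encodeInstance (i : SLDPCInstance) : List Γ' :=
  encodeNumber i.a ++ [Γ'.comma] ++ encodeNumber i.b ++ [Γ'.comma] ++ encodeGraph i.graph

/-- A family of vertex sequences is written sequence by sequence, each one between brackets, with
the vertices in binary and a comma after each vertex. -/
def encodeSequences (P : List (List ℕ)) : List Γ' :=
  P.flatMap fun p =>
    [Γ'.bra] ++ (p.flatMap fun v => encodeNumber v ++ [Γ'.comma]) ++ [Γ'.ket]

/-- A family of vertex sequences of a graph on `0, …, n - 1`, as sequences of natural numbers. -/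
def toNatSequences {n : ℕ} (P : List (List (Fin n))) : List (List ℕ) :=
  P.map fun p => p.map fun v => (v : ℕ)

/-- Min-DPC is polynomial-time solvable on the graphs of the class `C`. -/
def MinDPCPolyTimeOn (C : Set FiniteGraph) : Prop :=
  SolvableInPolyTime (fun g : {g : FiniteGraph // g ∈ C} => encodeGraph g.1) encodeSequences
    (fun g o => ∃ P, IsMinPathPartition g.1.G P ∧ o = toNatSequences P)

/-- There is a polynomial-time algorithm that, on all instances `(G, a, b)` of Min-SLDPC with `G`
in the class `C`, returns a solution within the factor `r a b` of the optimum. -/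
def SLDPCPolyTimeApproxOn (C : Set FiniteGraph) (r : ℕ → ℕ → ℝ) : Prop :=
  SolvableInPolyTime (fun i : {i : SLDPCInstance // i.graph ∈ C} => encodeInstance i.1)
    encodeSequences
    (fun i o => ∃ P, IsSLDPCApprox i.1.graph.G i.1.a i.1.b (r i.1.a i.1.b) P ∧
      o = toNatSequences P)

/-! A minimum path partition alone meets the ratio. With `n` vertices, its cost is at most `(n +
k)(a + b)`, where `k` is the number of paths of any competitor. Summing `3 w(p) + b |p| ≥ 3 a + 2 b`
over the competitor's paths bounds its cost below by `(n + k)(3 a + 2 b) / 3`. The quotient `3 (a +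
b) / (3 a + 2 b)` is at most both terms of `combinedRatio` (`IsMinPathPartition.cost_le`,
`le_combinedRatio`), so anything at least as cheap inherits the ratio.

Hence the algorithm need not read `a` and `b`: it deletes these two fields from the input and runs
the Min-DPC machine on the graph (`SolvableInPolyTime.of_graph`). -/

/-! ### Turing machines that ignore a leading field of the input -/

namespace SkipField

open Turing

variable {K : Type} {Γ : K → Type} {Λ σ : Type}

/-- The statement `q` for a machine with a further label `none` and a further Boolean register,
which `q` neither reads nor changes. -/
def liftStmt : TM2.Stmt Γ Λ σ → TM2.Stmt Γ (Option Λ) (σ × Bool)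
  | .push k f q => .push k (fun v => f v.1) (liftStmt q)
  | .peek k f q => .peek k (fun v s => (f v.1 s, v.2)) (liftStmt q)
  | .pop k f q => .pop k (fun v s => (f v.1 s, v.2)) (liftStmt q)
  | .load f q => .load (fun v => (f v.1, v.2)) (liftStmt q)
  | .branch f q₁ q₂ => .branch (fun v => f v.1) (liftStmt q₁) (liftStmt q₂)
  | .goto f => .goto (fun v => some (f v.1))
  | .halt => .halt

/-- The configuration `c`, with the value `false` in the further register. -/
def liftCfg (c : TM2.Cfg Γ Λ σ) : TM2.Cfg Γ (Option Λ) (σ × Bool) :=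
  ⟨c.l.map some, (c.var, false), c.stk⟩

variable [DecidableEq K]

theorem stepAux_liftStmt (q : TM2.Stmt Γ Λ σ) (v : σ) (S : ∀ k, List (Γ k)) :
    TM2.stepAux (liftStmt q) (v, false) S = liftCfg (TM2.stepAux q v S) := by
  induction q generalizing v S with
  | push k f q ih => exact ih _ _
  | peek k f q ih => exact ih _ _
  | pop k f q ih => exact ih _ _
  | load f q ih => exact ih _ _
  | branch f q₁ q₂ ih₁ ih₂ =>
    simp only [liftStmt, TM2.stepAux]
    cases f v
    · exact ih₂ _ _
    · exact ih₁ _ _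
  | goto f => rfl
  | halt => rfl

/-- The statement that pops a symbol from the stack `k`, goes to `l` if this symbol is `s`, and
repeats otherwise. -/
def skipStmt [∀ k, DecidableEq (Γ k)] (k : K) (s : Γ k) (l : Λ) :
    TM2.Stmt Γ (Option Λ) (σ × Bool) :=
  .pop k (fun v t => (v.1, decide (t = some s)))
    (.branch (fun v => v.2)
      -- The register is cleared before control passes to the simulated machine, as `liftCfg`
      -- demands.
      (.load (fun v => (v.1, false)) (.goto fun _ => some l))
      (.load (fun v => (v.1, false)) (.goto fun _ => none)))

/-- The program that removes all symbols up to the first `s` from the stack `k` and then runs the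
program `m` from the label `l`. -/
def skipProgram [∀ k, DecidableEq (Γ k)] (k : K) (s : Γ k) (l : Λ) (m : Λ → TM2.Stmt Γ Λ σ) :
    Option Λ → TM2.Stmt Γ (Option Λ) (σ × Bool)
  | none => skipStmt k s l
  | some l' => liftStmt (m l')

/-- Lifted statements never jump to the label `none`, so the simulation is exact, one step for one
step, including after halting. -/
theorem iterate_liftCfg [∀ k, DecidableEq (Γ k)] (k : K) (s : Γ k) (l : Λ)
    (m : Λ → TM2.Stmt Γ Λ σ) (n : ℕ) (c : Option (TM2.Cfg Γ Λ σ)) :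
    (flip bind (TM2.step (skipProgram k s l m)))^[n] (c.map liftCfg) =
      ((flip bind (TM2.step m))^[n] c).map liftCfg := by
  induction n generalizing c with
  | zero => rfl
  | succ n ih =>
    rw [Function.iterate_succ_apply, Function.iterate_succ_apply, ← ih]
    congr 1
    rcases c with _ | ⟨_ | l', v, S⟩
    · rfl
    · rfl
    · exact congrArg some (stepAux_liftStmt (m l') v S)

/-- Each pass through `skipStmt` is a single machine step: one per symbol of `u`, one for the
separator. -/
theorem iterate_skip [∀ k, DecidableEq (Γ k)] (k : K) (s : Γ k) (l : Λ)
    (m : Λ → TM2.Stmt Γ Λ σ) (v : σ) (u w : List (Γ k)) (hu : s ∉ u) (S : ∀ k, List (Γ k)) :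
    (flip bind (TM2.step (skipProgram k s l m)))^[u.length + 1]
        (some ⟨some none, (v, false), Function.update S k (u ++ s :: w)⟩) =
      some (liftCfg ⟨some l, v, Function.update S k w⟩) := by
  induction u with
  | nil => simp [flip, skipProgram, skipStmt, liftCfg]
  | cons x u ih =>
    rw [List.mem_cons, not_or] at hu
    rw [List.length_cons, Function.iterate_succ_apply, ← ih hu.2]
    congr 1
    simp [flip, skipProgram, skipStmt, Ne.symm hu.1]

end SkipField

open Classical in
/-- The machine that removes all symbols up to the first `s` from its input and then runs `tm`. -/
noncomputable def Turing.FinTM2.skipField (tm : FinTM2) (s : tm.Γ tm.k₀) : FinTM2 :=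
  { K := tm.K
    kDecidableEq := tm.kDecidableEq
    kFin := tm.kFin
    k₀ := tm.k₀
    k₁ := tm.k₁
    Γ := tm.Γ
    Λ := Option tm.Λ
    main := none
    ΛFin := @instFintypeOption _ tm.ΛFin
    σ := tm.σ × Bool
    initialState := (tm.initialState, false)
    σFin := @instFintypeProd _ _ tm.σFin _
    Γk₀Fin := tm.Γk₀Fin
    m := SkipField.skipProgram tm.k₀ s tm.main tm.m }

theorem Turing.initList_stk (tm : FinTM2) (u : List (tm.Γ tm.k₀)) :
    (initList tm u).stk = Function.update (fun _ => []) tm.k₀ u := by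
  funext k
  by_cases h : k = tm.k₀
  · subst h
    simp [initList]
  · simp [initList, h]

theorem Turing.iterate_step_skipField (tm : FinTM2) (s : tm.Γ tm.k₀) (u w : List (tm.Γ tm.k₀))
    (hu : s ∉ u) (o : List (tm.Γ tm.k₁)) (n : ℕ)
    (h : (flip bind tm.step)^[n] (some (initList tm w)) = some (haltList tm o)) :
    (flip bind (tm.skipField s).step)^[n + (u.length + 1)]
        (some (initList (tm.skipField s) (u ++ s :: w))) =
      some (haltList (tm.skipField s) o) := by
  classical
  have h₀ : initList (tm.skipField s) (u ++ s :: w) =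
      (⟨some none, (tm.initialState, false),
        Function.update (fun _ => []) tm.k₀ (u ++ s :: w)⟩ :
        TM2.Cfg tm.Γ (Option tm.Λ) (tm.σ × Bool)) := by
    rw [← initList_stk]
    rfl
  have h₁ : initList tm w =
      (⟨some tm.main, tm.initialState, Function.update (fun _ => []) tm.k₀ w⟩ :
        TM2.Cfg tm.Γ tm.Λ tm.σ) := by
    rw [← initList_stk]
    rfl
  rw [Function.iterate_add_apply, h₀]
  have h₂ := SkipField.iterate_skip tm.k₀ s tm.main tm.m tm.initialState u w hu (fun _ => [])
  have h₃ := SkipField.iterate_liftCfg tm.k₀ s tm.main tm.m n (some (initList tm w))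
  rw [h₁] at h₃ h
  -- The last `rfl` works because `haltList` asks for the initial state, and the register starts and
  -- ends at `false`.
  refine (congrArg _ h₂).trans (h₃.trans ((congrArg _ h).trans rfl))

/-- If `f` is computable in polynomial time, so is `f ∘ g`, for inputs `x` written as the code of
`g x` behind a further field that ends with the separator `s`. -/
theorem Turing.TM2ComputableInPolyTime.skipField {α β γ Γ₀ Γ₁ : Type} {ea : α → List Γ₀}
    {eb : β → List Γ₁} {f : α → β} (h : TM2ComputableInPolyTime ea eb f) (s : Γ₀)
    (ec : γ → List Γ₀) (g : γ → α) (hg : ∀ x, ∃ u, s ∉ u ∧ ec x = u ++ s :: ea (g x)) :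
    Nonempty (TM2ComputableInPolyTime ec eb (f ∘ g)) := by
  choose u hu hec using hg
  refine ⟨{ tm := h.tm.skipField (h.inputAlphabet.symm s)
            inputAlphabet := h.inputAlphabet
            outputAlphabet := h.outputAlphabet
            time := h.time + Polynomial.X
            outputsFun := fun x => ?_ }⟩
  have ho := h.outputsFun (g x)
  refine ⟨⟨ho.steps + ((u x).length + 1), ?_⟩, ?_⟩
  · have h₁ := Turing.iterate_step_skipField h.tm (h.inputAlphabet.symm s)
      ((u x).map h.inputAlphabet.symm) ((ea (g x)).map h.inputAlphabet.symm)
      (by simpa using hu x) _ _ ho.evals_in_steps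
    rw [List.length_map] at h₁
    rw [hec, List.map_append, List.map_cons]
    exact h₁
  · have h₁ := ho.steps_le_m
    have h₂ : (ea (g x)).length ≤ (ec x).length := by
      rw [hec, List.length_append, List.length_cons]
      omega
    have h₃ : (u x).length + 1 ≤ (ec x).length := by
      rw [hec, List.length_append, List.length_cons]
      omega
    rw [Polynomial.eval_add, Polynomial.eval_X]
    refine add_le_add (h₁.trans ?_) h₃
    -- A polynomial with natural coefficients is monotone, term by term.
    simp only [Polynomial.eval_eq_sum, Polynomial.sum]
    gcongr

/-! ### From graphs to Min-SLDPC instances. -/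

theorem comma_notMem_encodeNumber (m : ℕ) : Γ'.comma ∉ encodeNumber m := by
  simp [encodeNumber]

/-- Every problem on graphs that is solvable in polynomial time stays so if the graph is given as
part of an instance of Min-SLDPC. -/
theorem SolvableInPolyTime.of_graph {C : Set FiniteGraph} {O Γ₁ : Type} {encO : O → List Γ₁}
    {R : {g : FiniteGraph // g ∈ C} → O → Prop}
    (h : SolvableInPolyTime (fun g : {g : FiniteGraph // g ∈ C} => encodeGraph g.1) encO R)
    {R' : {i : SLDPCInstance // i.graph ∈ C} → O → Prop}
    (hR : ∀ i o, R ⟨i.1.graph, i.2⟩ o → R' i o) :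
    SolvableInPolyTime (fun i : {i : SLDPCInstance // i.graph ∈ C} => encodeInstance i.1)
      encO R' := by
  obtain ⟨f, hf, ⟨t⟩⟩ := h
  -- The wrappers are built from the inside out: `t₁` strips `b`, and `t₂` strips `a` before running
  -- `t₁`.
  obtain ⟨t₁⟩ := t.skipField Γ'.comma
    (fun i : {i : SLDPCInstance // i.graph ∈ C} =>
      encodeNumber i.1.b ++ [Γ'.comma] ++ encodeGraph i.1.graph)
    (fun i => ⟨i.1.graph, i.2⟩)
    (fun i => ⟨encodeNumber i.1.b, comma_notMem_encodeNumber _, by simp⟩)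
  obtain ⟨t₂⟩ := t₁.skipField Γ'.comma
    (fun i : {i : SLDPCInstance // i.graph ∈ C} => encodeInstance i.1) id
    (fun i => ⟨encodeNumber i.1.a, comma_notMem_encodeNumber _, by simp [encodeInstance]⟩)
  exact ⟨_, fun i => hR i _ (hf _), ⟨t₂⟩⟩

/-! ### The ratio of a minimum path partition -/

section Cost

variable {V : Type} {G : SimpleGraph V}

theorem IsPathPartition.sum_length [Fintype V] {P : List (List V)} (hP : IsPathPartition G P) :
    (P.map List.length).sum = Fintype.card V := by
  classical
  rw [← List.length_flatten, ← List.toFinset_card_of_nodup hP.2.1]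
  exact congrArg Finset.card (Finset.eq_univ_iff_forall.2 fun v => by simpa using hP.2.2 v)

theorem sum_pathWeight_le (a b : ℕ) (P : List (List V)) :
    (P.map (pathWeight a b)).sum ≤ P.length * (a + b) := by
  induction P with
  | nil => simp
  | cons p P ih =>
    have : pathWeight a b p ≤ a + b := by
      unfold pathWeight
      split <;> omega
    simp only [List.map_cons, List.sum_cons, List.length_cons]
    linarith

/-- As a path with one edge has two vertices, `3 w(p) + b |V(p)| ≥ 3 a + 2 b`. -/
theorem le_sum_pathWeight (a b : ℕ) (P : List (List V)) (hP : ∀ p ∈ P, p ≠ []) :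
    P.length * (3 * a + 2 * b) ≤
      3 * (P.map (pathWeight a b)).sum + b * (P.map List.length).sum := by
  induction P with
  | nil => simp
  | cons p P ih =>
    have ih := ih fun q hq => hP q (List.mem_cons_of_mem _ hq)
    have hp : 0 < p.length := List.length_pos_iff.2 (hP p List.mem_cons_self)
    have : 3 * a + 2 * b ≤ 3 * pathWeight a b p + b * p.length := by
      unfold pathWeight pathLength
      split
      · have : p.length = 2 := by omega
        rw [this]
        linarith
      · nlinarith
    simp only [List.map_cons, List.sum_cons, List.length_cons]
    linarith

/-- A minimum path partition is within the factor `3 (a + b) / (3 a + 2 b)` of the optimum of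
Min-SLDPC. -/
theorem IsMinPathPartition.cost_le [Fintype V] {P P' : List (List V)} (a b : ℕ)
    (hP : IsMinPathPartition G P) (hP' : IsPathPartition G P') :
    (3 * a + 2 * b) * sldpcCost V a b P ≤ 3 * (a + b) * sldpcCost V a b P' := by
  have h₁ := sum_pathWeight_le a b P
  have h₂ := le_sum_pathWeight a b P' fun p hp => (hP'.1 p hp).1
  rw [hP'.sum_length] at h₂
  have h₃ := hP.2 P' hP'
  calc (3 * a + 2 * b) * sldpcCost V a b P
      ≤ (3 * a + 2 * b) * (Fintype.card V * (a + b) + P'.length * (a + b)) := by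
        unfold sldpcCost
        gcongr
        exact h₁.trans (by gcongr)
    _ = (a + b) * (Fintype.card V * (3 * a + 2 * b) + P'.length * (3 * a + 2 * b)) := by ring
    -- The term `b n` is what `3 n (a + b)` has in excess of `n (3 a + 2 b)`.
    _ ≤ (a + b) * (Fintype.card V * (3 * a + 2 * b) +
          (3 * (P'.map (pathWeight a b)).sum + b * Fintype.card V)) := by gcongr
    _ = 3 * (a + b) * sldpcCost V a b P' := by
        unfold sldpcCost
        ring

end Cost

/-- As `a > b`, the factor of a minimum path partition is at most the ratio of the combined
strategy. So the combined strategy has this ratio as it is never worse than a minimum path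
partition, and no maximum matching has to be computed to attain the ratio. -/
theorem le_combinedRatio {a b : ℝ} (hb : 0 < b) (hab : b < a) :
    3 * (a + b) / (3 * a + 2 * b) ≤ combinedRatio a b := by
  have ha := hb.trans hab
  refine le_min ?_ ?_
  · rw [div_le_div_iff₀ (by positivity) ha]
    nlinarith
  -- Here `6 (a + b)² ≤ (3 a + 2 b)²` amounts to `2 b² ≤ 3 a²`.
  · rw [div_le_div_iff₀ (by positivity) (by positivity)]
    nlinarith

theorem IsMinPathPartition.isSLDPCApprox {V : Type} [Fintype V] {G : SimpleGraph V}
    {P S : List (List V)} {a b : ℕ} (hb : 0 < b) (hab : b < a) (hP : IsMinPathPartition G P)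
    (hS : IsPathPartition G S) (hSP : sldpcCost V a b S ≤ sldpcCost V a b P) :
    IsSLDPCApprox G a b (combinedRatio a b) S := by
  refine ⟨hS, fun P' hP' => ?_⟩
  have hb' : (0 : ℝ) < b := Nat.cast_pos.2 hb
  have hab' : (b : ℝ) < a := Nat.cast_lt.2 hab
  have h : (3 * a + 2 * b) * (sldpcCost V a b P : ℝ) ≤ 3 * (a + b) * sldpcCost V a b P' := by
    exact_mod_cast hP.cost_le a b hP'
  calc (sldpcCost V a b S : ℝ) ≤ sldpcCost V a b P := Nat.cast_le.2 hSP
    _ ≤ 3 * (a + b) / (3 * a + 2 * b) * sldpcCost V a b P' := by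
        rw [div_mul_eq_mul_div, le_div_iff₀ (by positivity)]
        linarith
    _ ≤ combinedRatio a b * sldpcCost V a b P' := by
        gcongr
        exact le_combinedRatio hb' hab'

/-! ### The worst case of the ratio -/

/-- In `t = a / b` the first term decreases and the second increases; they meet where `t² = 2 t +
2`, that is, at `t = 1 + √3`. -/
theorem combinedRatio_le {a b : ℝ} (hb : 0 < b) (hab : b < a) :
    combinedRatio a b ≤ (1 + √3) / 2 := by
  have h3 : √3 * √3 = 3 := Real.mul_self_sqrt (by norm_num)
  have h0 : 0 < √3 := by positivity
  have ha := hb.trans hab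
  rcases le_total a ((1 + √3) * b) with h | h
  · refine (min_le_right _ _).trans ?_
    rw [div_le_div_iff₀ (by positivity) (by norm_num)]
    nlinarith [mul_le_mul_of_nonneg_left h h0.le]
  · refine (min_le_left _ _).trans ?_
    rw [div_le_div_iff₀ ha (by norm_num)]
    nlinarith [mul_le_mul_of_nonneg_left h h0.le]

theorem combinedRatio_eq_iff {a b : ℝ} (hb : 0 < b) (hab : b < a) :
    combinedRatio a b = (1 + √3) / 2 ↔ a = (1 + √3) * b := by
  have h3 : √3 * √3 = 3 := Real.mul_self_sqrt (by norm_num)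
  have h1 : 1 < √3 := by nlinarith [Real.sqrt_nonneg 3]
  have h2 : √3 < 2 := by nlinarith [Real.sqrt_nonneg 3]
  have ha := hb.trans hab
  constructor
  · intro h
    have hl : (1 + √3) / 2 ≤ (a + b) / a := h ▸ min_le_left _ _
    have hr : (1 + √3) / 2 ≤ (3 * a + 2 * b) / (2 * a + 2 * b) := h ▸ min_le_right _ _
    rw [div_le_div_iff₀ (by norm_num) (by positivity)] at hl hr
    refine le_antisymm ?_ ?_
    -- The bounds read `(√3 - 1) a ≤ 2 b` and `(√3 - 1) b ≤ (2 - √3) a`; the factors `√3 + 1` and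
    -- `√3 + 2` rationalize the coefficients of `a`.
    · nlinarith [mul_le_mul_of_nonneg_left hl (by linarith : 0 ≤ √3 + 1)]
    · nlinarith [mul_le_mul_of_nonneg_left hr (by linarith : 0 ≤ √3 + 2)]
  · rintro rfl
    unfold combinedRatio
    have e₁ : ((1 + √3) * b + b) / ((1 + √3) * b) = (1 + √3) / 2 := by
      rw [div_eq_div_iff (by positivity) (by norm_num)]
      linear_combination (-b) * h3
    have e₂ : (3 * ((1 + √3) * b) + 2 * b) / (2 * ((1 + √3) * b) + 2 * b) = (1 + √3) / 2 := by
      rw [div_eq_div_iff (by positivity) (by norm_num)]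
      linear_combination (-2 * b) * h3
    rw [e₁, e₂, min_self]

theorem abs_half_one_add_sqrt_three_sub_lt : |(1 + √3) / 2 - 1.37| < (0.005 : ℝ) := by
  have h1 : 1.7320 < √3 := Real.lt_sqrt_of_sq_lt (by norm_num)
  have h2 : √3 < 1.7321 := (Real.sqrt_lt' (by norm_num)).2 (by norm_num)
  rw [abs_lt]
  constructor <;> linarith

/-! ### Assembly of the three claims. -/

theorem mainTheorem4 :
    -- the better one of the two strategies has the ratio `combinedRatio a b`
    (∀ (V : Type) [Fintype V] (G : SimpleGraph V) (a b : ℕ), 0 < b → b < a →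
      ∀ (P : List (List V)) (M : G.Subgraph) (Q S : List (List V)),
        IsMinPathPartition G P → IsMaximumMatching M → IsMatchingPartition M Q →
        (S = P ∨ S = Q) → sldpcCost V a b S = min (sldpcCost V a b P) (sldpcCost V a b Q) →
        IsSLDPCApprox G a b (combinedRatio a b) S) ∧
    -- this ratio is achieved in polynomial time where Min-DPC is polynomial
    (∀ C : Set FiniteGraph, MinDPCPolyTimeOn C →
      SLDPCPolyTimeApproxOn C (fun a b => combinedRatio a b) ∧
      SLDPCPolyTimeApproxOn C (fun _ _ => (1 + √3) / 2)) ∧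
    -- the worst case over all `a > b > 0`
    (∀ a b : ℝ, 0 < b → b < a →
      combinedRatio a b ≤ (1 + √3) / 2 ∧
      (combinedRatio a b = (1 + √3) / 2 ↔ a = (1 + √3) * b)) ∧
    |(1 + √3) / 2 - 1.37| < (0.005 : ℝ) := by
  refine ⟨?_, fun C hC => ⟨?_, ?_⟩,
    fun a b hb hab => ⟨combinedRatio_le hb hab, combinedRatio_eq_iff hb hab⟩,
    abs_half_one_add_sqrt_three_sub_lt⟩
  · intro V _ G a b hb hab P M Q S hP _ hQ hS hcost
    refine hP.isSLDPCApprox hb hab ?_ (hcost.trans_le (min_le_left _ _))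
    rcases hS with rfl | rfl
    · exact hP.1
    · exact hQ.1
  · exact SolvableInPolyTime.of_graph hC fun i _ ⟨P, hP, ho⟩ =>
      ⟨P, hP.isSLDPCApprox i.1.b_pos i.1.b_lt_a hP.1 le_rfl, ho⟩
  · refine SolvableInPolyTime.of_graph hC fun i _ ⟨P, hP, ho⟩ =>
      ⟨P, ⟨hP.1, fun P' hP' => ?_⟩, ho⟩
    refine ((hP.isSLDPCApprox i.1.b_pos i.1.b_lt_a hP.1 le_rfl).2 P' hP').trans ?_
    gcongr
    exact combinedRatio_le (Nat.cast_pos.2 i.1.b_pos) (Nat.cast_lt.2 i.1.b_lt_a)
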